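/- Let $\Sigma=\{0,\dots,d-1\}^{\mathbb N}$ with the lexicographic order and the shift $\sigma$, and let $\hat\sigma(x,y)=(\sigma x,(x_0,y_0,y_1,\dots))$ be the two-sided shift on $\Sigma\times\Sigma$ (future $x$, past $y$). Let $A:\Sigma\to\mathbb R$ be Hölder with a unique maximizing probability $\mu_\infty$, put $m(A)=\int A\,d\mu_\infty$, and let $\hat\mu_{max}$ be the natural extension of $\mu_\infty$, i.e. the $\hat\sigma$-invariant probability on $\Sigma\times\Sigma$ with first marginal $\mu_\infty$. Let $W$ be an involution kernel for $A$, i.e. a continuous function such that $A\circ\hat\sigma^{-1}+W\circ\hat\sigma^{-1}-W$ depends on $y$ only; let $V$ be a calibrated subaction, i.e. a continuous function with $V(x)=\max_{\sigma(z)=x}(V(z)+A(z)-m(A))$; let $I(x)=\sum_{n\ge 0}(V\circ\sigma-V-A+m(A))(\sigma^n x)\in[0,\infty]$; and let $c(x,y)=I(x)-W(x,y)+\gamma$ with a constant $\gamma\in\mathbb R$. Assume that $c$ is twist: $c(a,b)+c(a',b')>c(a,b')+c(a',b)$ whenever $a<a'$, $b<b'$ and these values are finite. Assume that $S=\operatorname{supp}\hat\mu_{max}$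 is a periodic orbit of $\hat\sigma$. Let $x_0$ be the smallest point of the projection of $S$ to the first coordinate and $y_0$ the smallest point with $(x_0,y_0)\in S$. Let $f:\Sigma\to\mathbb R\cup\{\infty\}$ be the Rüschendorf potential of $S$ with base point $(x_0,y_0)$, $$f(z)=\inf\Big\{\big(c(z,v_n)-c(u_n,v_n)\big)+\sum_{i=0}^{n-1}\big(c(u_{i+1},v_i)-c(u_i,v_i)\big)\Big\},$$ the infimum over all $n\ge 0$ and all chains $(u_0,v_0)=(x_0,y_0)$, $(u_1,v_1),\dots,(u_n,v_n)\in S$. Then $S$ consists of points $(x_0,y_0),\dots,(x_N,y_N)$ with $x_0<x_1<\dots<x_N$ (so each $x_i$ has exactly one fibre point $y_i$), and for every $z\in\Sigma$ $$f(z)=\big(c(z,y_n)-c(x_n,y_n)\big)+\sum_{i=0}^{n-1}\big(c(x_{i+1},y_i)-c(x_i,y_i)\big),$$ where $x_0<\dots<x_n$ are all the points of the projection of $S$ that are strictly smaller than $z$ (and $n=0$ if there are none); in particular $n=k-1$ if $x_{k-1}<z\le x_k$. Moreover, let $\hat\partial_c f(x)=\{y\in\Sigma : f(z)-f(x)\le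 c(z,y)-c(x,y)\ \text{for all } z\in\Sigma\}$ be the set of $c$-subderivatives of $f$ at $x$. Then $y_k\in\hat\partial_c f(x_k)$ for every $0\le k\le N$. More precisely, if $N\ge 1$, then $\hat\partial_c f(x_0)=\{y_0\}$, and $\hat\partial_c f(x_k)=\{y : y_k\le y\le y_{k-1}\}$ for $1\le k\le N$. -/

import Mathlib

open MeasureTheory

namespace BernoulliTransport

/-- The Bernoulli space of one-sided sequences over an alphabet with `d` symbols (product topology,
Borel sets). It serves as the space of futures `x = (x₀, x₁, …)` and as the space of pasts
`y = (y₀, y₁, …)`, where `y₀` is the symbol immediately to the left of `x₀`. -/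
abbrev BSpace (d : ℕ) : Type := ℕ → Fin d

variable {d : ℕ}

/-- The strict lexicographic order: `x` and `z` agree before some index, where `x` is smaller. -/
def LexLT (x z : BSpace d) : Prop := toLex x < toLex z

/-- The weak lexicographic order. -/
def LexLE (x z : BSpace d) : Prop := toLex x ≤ toLex z

/-- The one-sided shift. -/
def shift (x : BSpace d) : BSpace d := fun n => x (n + 1)

/-- The sequence `(a, x₀, x₁, …)`. -/
def prepend (a : Fin d) (x : BSpace d) : BSpace d
  | 0 => a
  | n + 1 => x n

/-- The two-sided shift on pairs (future, past): `(x, y) ↦ (σ x, (x₀, y₀, y₁, …))`. -/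
def biShift (p : BSpace d × BSpace d) : BSpace d × BSpace d := (shift p.1, prepend (p.1 0) p.2)

/-- Hölder continuity with respect to the metrics `d(x, z) = lam ^ min {j | x j ≠ z j}`
(the exponent and `lam` are absorbed in `θ`). -/
def IsHolder (A : BSpace d → ℝ) : Prop :=
  ∃ C θ : ℝ, 0 < θ ∧ θ < 1 ∧
    ∀ (n : ℕ) (x z : BSpace d), (∀ i < n, x i = z i) → |A x - A z| ≤ C * θ ^ n

/-- Shift-invariant Borel probability measures. -/
def InvariantProb (ν : Measure (BSpace d)) : Prop :=
  IsProbabilityMeasure ν ∧ MeasurePreserving shift ν ν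

/-- `m(A)`, the maximal value of `∫ A dν` over invariant probabilities. -/
noncomputable def maxValue (A : BSpace d → ℝ) : ℝ :=
  sSup {r : ℝ | ∃ ν : Measure (BSpace d), InvariantProb ν ∧ r = ∫ x, A x ∂ν}

/-- Maximizing probabilities for `A`. -/
def IsMaximizing (A : BSpace d → ℝ) (μ : Measure (BSpace d)) : Prop :=
  InvariantProb μ ∧ ∀ ν : Measure (BSpace d), InvariantProb ν → ∫ x, A x ∂ν ≤ ∫ x, A x ∂μ

/-- `μhat` is the natural extension of the invariant probability `μ`: the (unique) probability
invariant under the two-sided shift whose projection to the futures is `μ`. -/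
def IsNaturalExtension (μ : Measure (BSpace d)) (μhat : Measure (BSpace d × BSpace d)) : Prop :=
  IsProbabilityMeasure μhat ∧ MeasurePreserving biShift μhat μhat ∧ μhat.map Prod.fst = μ

/-- Calibrated subactions:
`V` is continuous and `V x = max {V z + A z - m(A) | σ z = x}` for every `x`. -/
def IsCalibratedSubaction (A V : BSpace d → ℝ) : Prop :=
  Continuous V ∧
    ∀ x, IsGreatest ((fun z => V z + A z - maxValue A) '' {z | shift z = x}) (V x)

/-- `W` is an involution kernel for `A`: it is continuous, and the inverse two-sided shift
`(x, y) ↦ ((y₀, x₀, x₁, …), σ y)` turns `A` into a function `Adual` of the past alone. -/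
def IsInvolutionKernel (A : BSpace d → ℝ) (W : BSpace d × BSpace d → ℝ) : Prop :=
  Continuous W ∧ ∃ Adual : BSpace d → ℝ, ∀ x y : BSpace d,
    Adual y = A (prepend (y 0) x) + W (prepend (y 0) x, shift y) - W (x, y)

/-- The deviation function `I x = ∑ₙ (V ∘ σ - V - A + m(A)) (σⁿ x)`, with values in `[0, ∞]`.
The terms are nonnegative when `V` is a calibrated subaction for `A`. -/
noncomputable def deviation (A V : BSpace d → ℝ) (x : BSpace d) : ENNReal :=
  ∑' n : ℕ, ENNReal.ofReal
    (V (shift (shift^[n] x)) - V (shift^[n] x) - A (shift^[n] x) + maxValue A)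

/-- The cost `c(x, y) = I x - W(x, y) + γ`, with values in `(-∞, ∞]`. -/
noncomputable def cost (A V : BSpace d → ℝ) (W : BSpace d × BSpace d → ℝ) (γ : ℝ) (x y : BSpace d) : EReal :=
  (deviation A V x : EReal) - (W (x, y) : EReal) + (γ : EReal)

/-- The twist condition for a cost, required where the values involved are finite. -/
def IsTwist (c : BSpace d → BSpace d → EReal) : Prop :=
  ∀ a a' b b' : BSpace d, LexLT a a' → LexLT b b' →
    c a b ≠ ⊤ → c a' b' ≠ ⊤ → c a b' ≠ ⊤ → c a' b ≠ ⊤ →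
      c a b' + c a' b < c a b + c a' b'

/-- For points `p 0 = (x₀, y₀), …, p n = (xₙ, yₙ)`, the chain sum
`(c(z, yₙ) - c(xₙ, yₙ)) + ∑_{i < n} (c(xᵢ₊₁, yᵢ) - c(xᵢ, yᵢ))`. -/
noncomputable def chainSum (c : BSpace d → BSpace d → EReal) (p : ℕ → BSpace d × BSpace d) (n : ℕ)
    (z : BSpace d) : EReal :=
  (c z (p n).2 - c (p n).1 (p n).2) +
    ∑ i ∈ Finset.range n, (c (p (i + 1)).1 (p i).2 - c (p i).1 (p i).2)

/-- The Rüschendorf potential of `S` with base point `p₀`: the infimum of the chain sums over all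
finite chains in `S` that start at `p₀`. -/
noncomputable def potential (c : BSpace d → BSpace d → EReal) (S : Set (BSpace d × BSpace d))
    (p₀ : BSpace d × BSpace d) (z : BSpace d) : EReal :=
  sInf {r : EReal | ∃ (n : ℕ) (p : ℕ → BSpace d × BSpace d),
    p 0 = p₀ ∧ (∀ j, 1 ≤ j → j ≤ n → p j ∈ S) ∧ r = chainSum c p n z}

/-- The set of `c`-subderivatives of `f` at `x`. -/
def cSubdiff (c : BSpace d → BSpace d → EReal) (f : BSpace d → EReal) (x : BSpace d) : Set (BSpace d) :=
  {y | ∀ z, f z - f x ≤ c z y - c x y}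

end BernoulliTransport

/-! On the set `D` of futures with finite deviation the cost is real, and twist says that `c(a', y)
- c(a, y)` increases in `y` when `a < a'`. If a finite set in `D × Σ` is antitone (larger future,
smaller past), comparing each increment with its value at a fixed past and telescoping gives
`realChain_sub_le`: with `f` the chain sum along the ordered list, `f(z) - f(xᵢ) ≤ c(z, y) - c(xᵢ,
y)` for every `y` between `yᵢ` and `yᵢ₋₁`. Used along an arbitrary chain, this shows that the
ordered chain is optimal; used at one point, it gives subderivatives. Strict twist excludes all
other `y`, provided `D` has points on both sides of the support (`exists_lexLT_of_shift_ne`).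

The support is antitone because, for `(a, b)` in it, `z ↦ W(z, b) - V(z)` is maximal at `z = a`
(`sub_le_sub_of_defect_eq_zero`). Adding this for two points contradicts twist if they are ordered
alike. Fibres are single points because a periodic past is determined by its future. -/

namespace BernoulliTransport

variable {d : ℕ}

/-! ### Chain sums and subderivatives for antitone finite sets under twist. -/

section Combinatorics

variable {D : Set (BSpace d)} {k : BSpace d → BSpace d → ℝ} {c : BSpace d → BSpace d → EReal}
  {p : ℕ → BSpace d × BSpace d} {N : ℕ}

/-- The real-valued twist condition on the set `D` of first coordinates. -/
def RealTwist (D : Set (BSpace d)) (k : BSpace d → BSpace d → ℝ) : Prop :=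
  ∀ a ∈ D, ∀ a' ∈ D, ∀ b b', LexLT a a' → LexLT b b' → k a b' + k a' b < k a b + k a' b'

theorem LexLE.eq_or_lt {x z : BSpace d} (h : LexLE x z) : x = z ∨ LexLT x z := by
  rcases eq_or_lt_of_le (show toLex x ≤ toLex z from h) with h | h
  · exact Or.inl (toLex.injective h)
  · exact Or.inr h

theorem LexLT.le {x z : BSpace d} (h : LexLT x z) : LexLE x z :=
  le_of_lt (show toLex x < toLex z from h)

theorem LexLE.refl (x : BSpace d) : LexLE x x := le_refl (toLex x)

theorem LexLE.trans {x y z : BSpace d} (h : LexLE x y) (h' : LexLE y z) : LexLE x z :=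
  le_trans (show toLex x ≤ toLex y from h) h'

theorem LexLE.antisymm {x y : BSpace d} (h : LexLE x y) (h' : LexLE y x) : x = y :=
  toLex.injective (le_antisymm (show toLex x ≤ toLex y from h) h')

theorem LexLT.not_le {x y : BSpace d} (h : LexLT x y) : ¬ LexLE y x :=
  not_le_of_gt (show toLex x < toLex y from h)

theorem lexLT_of_not_le {x y : BSpace d} (h : ¬ LexLE x y) : LexLT y x :=
  lt_of_not_ge (show ¬ toLex x ≤ toLex y from h)

theorem RealTwist.le (hk : RealTwist D k) {a a' b b' : BSpace d} (ha : a ∈ D) (ha' : a' ∈ D)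
    (h : LexLE a a') (h' : LexLE b b') : k a' b - k a b ≤ k a' b' - k a b' := by
  rcases h.eq_or_lt with rfl | h
  · simp
  rcases h'.eq_or_lt with rfl | h'
  · simp
  linarith [hk a ha a' ha' b b' h h']

/-- The increments of a chain between consecutive points. -/
noncomputable def linkSum (k : BSpace d → BSpace d → ℝ) (p : ℕ → BSpace d × BSpace d) (n : ℕ) : ℝ :=
  ∑ i ∈ Finset.range n, (k (p (i + 1)).1 (p i).2 - k (p i).1 (p i).2)

theorem linkSum_succ (n : ℕ) : linkSum k p (n + 1) =
    linkSum k p n + (k (p (n + 1)).1 (p n).2 - k (p n).1 (p n).2) :=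
  Finset.sum_range_succ _ _

/-- Each link moves right at a past at most `y`, so by twist it costs no more than the same move at
`y`; the moves at `y` telescope. `le_linkSum_sub` is the mirror image. -/
theorem linkSum_sub_le (hk : RealTwist D k) (hD : ∀ j ≤ N, (p j).1 ∈ D)
    (hx : ∀ i j, i < j → j ≤ N → LexLT (p i).1 (p j).1) {i : ℕ} {y : BSpace d}
    (hy : ∀ j, i ≤ j → j ≤ N → LexLE (p j).2 y) {n : ℕ} (hin : i ≤ n) (hn : n ≤ N) :
    linkSum k p n - linkSum k p i ≤ k (p n).1 y - k (p i).1 y := by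
  induction n, hin using Nat.le_induction with
  | base => simp
  | succ n hin ih =>
    have := hk.le (hD n (by omega)) (hD (n + 1) hn) (hx n (n + 1) (by omega) hn).le
      (hy n hin (by omega))
    rw [linkSum_succ]
    linarith [ih (by omega)]

theorem le_linkSum_sub (hk : RealTwist D k) (hD : ∀ j ≤ N, (p j).1 ∈ D)
    (hx : ∀ i j, i < j → j ≤ N → LexLT (p i).1 (p j).1) {i : ℕ} {y : BSpace d}
    (hy : ∀ j, j < i → LexLE y (p j).2) {n : ℕ} (hin : n ≤ i) (hi : i ≤ N) :
    k (p i).1 y - k (p n).1 y ≤ linkSum k p i - linkSum k p n := by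
  induction i, hin using Nat.le_induction with
  | base => simp
  | succ i hin ih =>
    have := hk.le (hD i (by omega)) (hD (i + 1) hi) (hx i (i + 1) (by omega) hi).le
      (hy i (by omega))
    rw [linkSum_succ]
    linarith [ih (fun j hj => hy j (by omega)) (by omega)]

/-- The real-valued chain sum. -/
noncomputable def realChain (k : BSpace d → BSpace d → ℝ) (p : ℕ → BSpace d × BSpace d) (n : ℕ)
    (z : BSpace d) : ℝ :=
  (k z (p n).2 - k (p n).1 (p n).2) + linkSum k p n

theorem realChain_self (n : ℕ) : realChain k p n (p n).1 = linkSum k p n := by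
  simp [realChain]

/-- Subdifferential inequality for the monotone chain. -/
theorem realChain_sub_le (hk : RealTwist D k) (hD : ∀ j ≤ N, (p j).1 ∈ D)
    (hx : ∀ i j, i < j → j ≤ N → LexLT (p i).1 (p j).1) {i : ℕ} (hi : i ≤ N) {y : BSpace d}
    (hy : ∀ j, i ≤ j → j ≤ N → LexLE (p j).2 y) (hy' : ∀ j, j < i → LexLE y (p j).2)
    (hy₀ : LexLE y (p 0).2) {z : BSpace d} (hz : z ∈ D) {n : ℕ} (hn : n ≤ N)
    (hnz : n = 0 ∨ LexLE (p n).1 z) (hzn : ∀ j, n < j → j ≤ N → LexLE z (p j).1) :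
    realChain k p n z - linkSum k p i ≤ k z y - k (p i).1 y := by
  unfold realChain
  rcases le_or_gt i n with hin | hin
  · have h1 := linkSum_sub_le hk hD hx hy hin hn
    suffices k z (p n).2 - k (p n).1 (p n).2 ≤ k z y - k (p n).1 y by linarith
    by_cases h : LexLE (p n).1 z
    · exact hk.le (hD n hn) hz h (hy n hin hn)
    -- Here `z` lies left of `x₀`, which reverses the twist comparison; this is where `hy₀` enters.
    · obtain rfl : n = 0 := hnz.resolve_right h
      linarith [hk.le hz (hD 0 hn) (lexLT_of_not_le h).le hy₀]
  -- Now `z ≤ xₙ₊₁`, so the sum is compared from `xₙ₊₁` to `xᵢ`, and the remaining move from `z` to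
  -- `xₙ₊₁` is made at `yₙ`.
  · have h1 := le_linkSum_sub hk hD hx hy' (Nat.succ_le_of_lt hin) hi
    have h2 := hk.le hz (hD (n + 1) (by omega)) (hzn (n + 1) (by omega) (by omega)) (hy' n hin)
    have h3 := linkSum_succ (k := k) (p := p) n
    simp only [Nat.succ_eq_add_one] at h1
    linarith

theorem chainSum_eq_coe (hc : ∀ z ∈ D, ∀ y, c z y = k z y) {u : ℕ → BSpace d × BSpace d} {n : ℕ}
    (hu : ∀ j ≤ n, (u j).1 ∈ D) {z : BSpace d} (hz : z ∈ D) :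
    chainSum c u n z = realChain k u n z := by
  have hs : ∀ m ≤ n, ∑ i ∈ Finset.range m, (c (u (i + 1)).1 (u i).2 - c (u i).1 (u i).2)
      = ((linkSum k u m : ℝ) : EReal) := by
    intro m hm
    induction m with
    | zero => simp [linkSum]
    | succ m ih =>
      rw [Finset.sum_range_succ, ih (by omega), linkSum_succ, hc _ (hu _ hm), hc _ (hu m (by omega))]
      push_cast
      rfl
  rw [chainSum, hs n le_rfl, hc z hz, hc _ (hu n le_rfl), realChain]
  push_cast
  rfl

theorem chainSum_eq_top (hc : ∀ z ∈ D, ∀ y, c z y = k z y) (hc' : ∀ z ∉ D, ∀ y, c z y = ⊤)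
    {u : ℕ → BSpace d × BSpace d} {n : ℕ}
    (hu : ∀ j ≤ n, (u j).1 ∈ D) {z : BSpace d} (hz : z ∉ D) :
    chainSum c u n z = ⊤ := by
  -- Evaluated at its own last point the chain sum reduces to its links, which are therefore finite.
  have h := chainSum_eq_coe hc hu (hu n le_rfl)
  have hs : ∑ i ∈ Finset.range n, (c (u (i + 1)).1 (u i).2 - c (u i).1 (u i).2)
      = ((linkSum k u n : ℝ) : EReal) := by
    rw [chainSum, hc _ (hu n le_rfl), ← EReal.coe_sub, sub_self, EReal.coe_zero, zero_add,
      realChain_self] at h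
    exact h
  rw [chainSum, hs, hc' z hz, hc _ (hu n le_rfl), EReal.top_sub_coe, EReal.top_add_coe]

/-- A finite antitone set of pairs, listed by increasing first coordinate, inside the domain where
the cost `c` takes the finite values `k`. -/
structure MonotoneChain (D : Set (BSpace d)) (k : BSpace d → BSpace d → ℝ)
    (c : BSpace d → BSpace d → EReal) (p : ℕ → BSpace d × BSpace d) (N : ℕ) : Prop where
  twist : RealTwist D k
  finite : ∀ z ∈ D, ∀ y, c z y = k z y
  infinite : ∀ z ∉ D, ∀ y, c z y = ⊤
  mem : ∀ j ≤ N, (p j).1 ∈ D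
  lt : ∀ i j, i < j → j ≤ N → LexLT (p i).1 (p j).1
  ge : ∀ i j, i ≤ j → j ≤ N → LexLE (p j).2 (p i).2

namespace MonotoneChain

variable (H : MonotoneChain D k c p N)
include H

/-- Optimality of the ordered chain, by induction on the length of the competitor: each jump from
`xᵢ` to `xᵢ'` at past `yᵢ` costs at least the difference of the ordered sums. -/
theorem linkSum_le {u : ℕ → BSpace d × BSpace d} {m : ℕ} (h0 : u 0 = p 0)
    (hu : ∀ j, 1 ≤ j → j ≤ m → u j ∈ p '' Set.Iic N) :
    ∃ i ≤ N, u m = p i ∧ linkSum k p i ≤ linkSum k u m := by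
  induction m with
  | zero => exact ⟨0, Nat.zero_le _, h0, le_of_eq rfl⟩
  | succ m ih =>
    obtain ⟨i, hi, hui, hle⟩ := ih fun j h1 h2 => hu j h1 (by omega)
    obtain ⟨i', hi', hui'⟩ := hu (m + 1) (by omega) le_rfl
    refine ⟨i', hi', hui'.symm, ?_⟩
    have := realChain_sub_le H.twist H.mem H.lt hi (fun j h1 h2 => H.ge i j h1 h2)
      (fun j h1 => H.ge j i h1.le hi) (H.ge 0 i (Nat.zero_le _) hi) (H.mem i' hi') hi'
      (Or.inr (LexLE.refl _)) (fun j h1 h2 => (H.lt i' j h1 h2).le)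
    rw [realChain_self] at this
    rw [linkSum_succ, ← hui', hui]
    linarith

theorem potential_eq {z : BSpace d} {n : ℕ} (hn : n ≤ N) (hnz : n = 0 ∨ LexLE (p n).1 z)
    (hzn : ∀ j, n < j → j ≤ N → LexLE z (p j).1) :
    potential c (p '' Set.Iic N) (p 0) z = chainSum c p n z := by
  apply le_antisymm
  · exact sInf_le ⟨n, p, rfl, fun j _ h => ⟨j, h.trans hn, rfl⟩, rfl⟩
  · apply le_sInf
    rintro r ⟨m, u, h0, hu, rfl⟩
    have huD : ∀ j ≤ m, (u j).1 ∈ D := by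
      intro j hj
      rcases Nat.eq_zero_or_pos j with rfl | h
      · rw [h0]; exact H.mem 0 (Nat.zero_le _)
      · obtain ⟨i, hi, h⟩ := hu j h hj
        rw [← h]; exact H.mem i hi
    by_cases hz : z ∈ D
    · rw [chainSum_eq_coe H.finite huD hz,
        chainSum_eq_coe H.finite (fun j hj => H.mem j (hj.trans hn)) hz, EReal.coe_le_coe_iff]
      obtain ⟨i, hi, hui, hle⟩ := H.linkSum_le h0 hu
      have := realChain_sub_le H.twist H.mem H.lt hi (fun j h1 h2 => H.ge i j h1 h2)
        (fun j h1 => H.ge j i h1.le hi) (H.ge 0 i (Nat.zero_le _) hi) hz hn hnz hzn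
      rw [realChain.eq_def k u, hui]
      linarith
    · rw [chainSum_eq_top H.finite H.infinite huD hz]
      exact le_top

theorem potential_eq_realChain {z : BSpace d} (hz : z ∈ D) {n : ℕ} (hn : n ≤ N)
    (hnz : n = 0 ∨ LexLE (p n).1 z) (hzn : ∀ j, n < j → j ≤ N → LexLE z (p j).1) :
    potential c (p '' Set.Iic N) (p 0) z = realChain k p n z := by
  rw [H.potential_eq hn hnz hzn, chainSum_eq_coe H.finite (fun j hj => H.mem j (hj.trans hn)) hz]

theorem potential_apply {i : ℕ} (hi : i ≤ N) :
    potential c (p '' Set.Iic N) (p 0) (p i).1 = (linkSum k p i : ℝ) := by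
  rw [H.potential_eq_realChain (H.mem i hi) hi (Or.inr (LexLE.refl _))
    (fun j h1 h2 => (H.lt i j h1 h2).le), realChain_self]

omit H in
theorem exists_position (p : ℕ → BSpace d × BSpace d) (N : ℕ) (z : BSpace d) :
    ∃ n ≤ N, (n = 0 ∨ LexLE (p n).1 z) ∧ ∀ j, n < j → j ≤ N → LexLE z (p j).1 := by
  classical
  -- The default value `0` covers a point `z` to the left of the whole list.
  refine ⟨Nat.findGreatest (fun n => LexLE (p n).1 z) N, Nat.findGreatest_le _, ?_, ?_⟩
  · rcases Nat.eq_zero_or_pos (Nat.findGreatest (fun n => LexLE (p n).1 z) N) with h | h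
    · exact Or.inl h
    · exact Or.inr (Nat.findGreatest_of_ne_zero rfl h.ne')
  · intro j h1 h2
    exact (lexLT_of_not_le (Nat.findGreatest_is_greatest h1 h2)).le

/-- For `i = 0` the condition `hy'` is vacuous, and `hy₀` supplies the upper bound. -/
theorem mem_cSubdiff {i : ℕ} (hi : i ≤ N) {y : BSpace d} (hy : LexLE (p i).2 y)
    (hy' : ∀ j, j < i → LexLE y (p j).2) (hy₀ : LexLE y (p 0).2) :
    y ∈ cSubdiff c (potential c (p '' Set.Iic N) (p 0)) (p i).1 := by
  intro z
  rw [H.potential_apply hi, H.finite _ (H.mem i hi)]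
  by_cases hz : z ∈ D
  · obtain ⟨n, hn, hnz, hzn⟩ := exists_position p N z
    rw [H.potential_eq_realChain hz hn hnz hzn, H.finite z hz, ← EReal.coe_sub, ← EReal.coe_sub,
      EReal.coe_le_coe_iff]
    exact realChain_sub_le H.twist H.mem H.lt hi (fun j h1 h2 => (H.ge i j h1 h2).trans hy) hy' hy₀
      hz hn hnz hzn
  · rw [H.infinite z hz, EReal.top_sub_coe]
    exact le_top

theorem realChain_sub_le_of_mem_cSubdiff {i : ℕ} (hi : i ≤ N) {y : BSpace d}
    (hy : y ∈ cSubdiff c (potential c (p '' Set.Iic N) (p 0)) (p i).1) {z : BSpace d} (hz : z ∈ D)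
    {n : ℕ} (hn : n ≤ N) (hnz : n = 0 ∨ LexLE (p n).1 z)
    (hzn : ∀ j, n < j → j ≤ N → LexLE z (p j).1) :
    realChain k p n z - linkSum k p i ≤ k z y - k (p i).1 y := by
  have := hy z
  rwa [H.potential_apply hi, H.finite _ (H.mem i hi), H.potential_eq_realChain hz hn hnz hzn,
    H.finite z hz, ← EReal.coe_sub, ← EReal.coe_sub, EReal.coe_le_coe_iff] at this

/-- A subderivative at `xᵢ` is at least `yᵢ` as soon as `D` has a point to the right of `xᵢ`. -/
theorem ge_of_mem_cSubdiff (hmax : ∃ z ∈ D, LexLT (p N).1 z) {i : ℕ} (hi : i ≤ N) {y : BSpace d}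
    (hy : y ∈ cSubdiff c (potential c (p '' Set.Iic N) (p 0)) (p i).1) : LexLE (p i).2 y := by
  by_contra hlt
  replace hlt := lexLT_of_not_le hlt
  -- The test point lies to the right of `xᵢ` where the potential is still the chain sum ending at
  -- `i`: the next list point, or one beyond the list when `i = N`.
  obtain ⟨z, hz, hxz, hzn⟩ : ∃ z ∈ D, LexLT (p i).1 z ∧ ∀ j, i < j → j ≤ N → LexLE z (p j).1 := by
    rcases hi.eq_or_lt with rfl | hi'
    · obtain ⟨z, hz, h⟩ := hmax
      exact ⟨z, hz, h, fun j h1 h2 => absurd h2 (by omega)⟩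
    · refine ⟨_, H.mem (i + 1) hi', H.lt i (i + 1) (by omega) hi', fun j h1 h2 => ?_⟩
      rcases (show i + 1 ≤ j from h1).eq_or_lt with rfl | h
      · exact LexLE.refl _
      · exact (H.lt (i + 1) j h h2).le
  have h1 := H.realChain_sub_le_of_mem_cSubdiff hi hy hz hi (Or.inr hxz.le) hzn
  have h2 := H.twist _ (H.mem i hi) z hz _ _ hxz hlt
  rw [realChain] at h1
  linarith

/-- A subderivative at `xᵢ₊₁` is at most `yᵢ`. -/
theorem le_of_mem_cSubdiff {i : ℕ} (hi : i < N) {y : BSpace d}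
    (hy : y ∈ cSubdiff c (potential c (p '' Set.Iic N) (p 0)) (p (i + 1)).1) :
    LexLE y (p i).2 := by
  by_contra hlt
  replace hlt := lexLT_of_not_le hlt
  have h1 := H.realChain_sub_le_of_mem_cSubdiff hi hy (H.mem i hi.le) hi.le (Or.inr (LexLE.refl _))
    (fun j h1 h2 => (H.lt i j h1 h2).le)
  have h2 := H.twist _ (H.mem i hi.le) _ (H.mem (i + 1) hi) _ _ (H.lt i (i + 1) (by omega) hi) hlt
  rw [realChain_self, linkSum_succ] at h1
  linarith

/-- A subderivative at `x₀` is at most `y₀` as soon as `D` has a point to the left of `x₀`. -/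
theorem le_of_mem_cSubdiff_zero (hmin : ∃ z ∈ D, LexLT z (p 0).1) {y : BSpace d}
    (hy : y ∈ cSubdiff c (potential c (p '' Set.Iic N) (p 0)) (p 0).1) :
    LexLE y (p 0).2 := by
  by_contra hlt
  replace hlt := lexLT_of_not_le hlt
  obtain ⟨z, hz, hlz⟩ := hmin
  have h1 := H.realChain_sub_le_of_mem_cSubdiff (Nat.zero_le _) hy hz (Nat.zero_le _) (Or.inl rfl)
    (fun j h1 h2 => hlz.le.trans (H.lt 0 j h1 h2).le)
  have h2 := H.twist z hz _ (H.mem 0 (Nat.zero_le _)) _ _ hlz hlt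
  rw [realChain] at h1
  linarith

end MonotoneChain

end Combinatorics

/-! ### Enumeration of the support, and periodic points of the two-sided shift. -/

theorem exists_strictMono_enumeration {α X : Type*} [LinearOrder X] {S : Set α} (hS : S.Finite)
    (hne : S.Nonempty) (φ : α → X) (hφ : S.InjOn φ) :
    ∃ (N : ℕ) (p : ℕ → α), p '' Set.Iic N = S ∧ ∀ i j, i < j → j ≤ N → φ (p i) < φ (p j) := by
  classical
  set F : Finset X := hS.toFinset.image φ
  have hFne : F.Nonempty := by
    obtain ⟨a, ha⟩ := hne
    exact ⟨φ a, Finset.mem_image_of_mem _ (hS.mem_toFinset.2 ha)⟩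
  obtain ⟨N, hN⟩ : ∃ N, F.card = N + 1 := ⟨F.card - 1, by have := hFne.card_pos; omega⟩
  have hg : ∀ i : Fin (N + 1), ∃ a ∈ S, φ a = F.orderEmbOfFin hN i := by
    intro i
    obtain ⟨a, ha, h⟩ := Finset.mem_image.1 (F.orderEmbOfFin_mem hN i)
    exact ⟨a, hS.mem_toFinset.1 ha, h⟩
  choose g hgS hg using hg
  refine ⟨N, fun i => g (Fin.ofNat (N + 1) i), Set.Subset.antisymm ?_ ?_, ?_⟩
  · rintro _ ⟨i, -, rfl⟩
    exact hgS _
  · intro a ha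
    have : φ a ∈ Set.range (F.orderEmbOfFin hN) := by
      rw [Finset.range_orderEmbOfFin]
      exact Finset.mem_image_of_mem _ (hS.mem_toFinset.2 ha)
    obtain ⟨i, hi⟩ := this
    refine ⟨i, Nat.lt_succ_iff.1 i.2, hφ (hgS _) ha ?_⟩
    simp only [hg, ← hi]
    simp
  · intro i j hij hj
    simp only [hg]
    apply (F.orderEmbOfFin hN).strictMono
    rw [Fin.lt_def]
    simp only [Fin.ofNat]
    rwa [Nat.mod_eq_of_lt (by omega), Nat.mod_eq_of_lt (by omega)]

/-- The inverse of the two-sided shift. -/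
def biShiftInv (p : BSpace d × BSpace d) : BSpace d × BSpace d := (prepend (p.2 0) p.1, shift p.2)

theorem shift_prepend (a : Fin d) (x : BSpace d) : shift (prepend a x) = x := rfl

theorem prepend_shift (x : BSpace d) : prepend (x 0) (shift x) = x := by
  funext n
  cases n <;> rfl

theorem biShiftInv_biShift : Function.LeftInverse (biShiftInv (d := d)) biShift := fun p =>
  Prod.ext (prepend_shift p.1) rfl

theorem continuous_shift : Continuous (shift (d := d)) :=
  continuous_pi fun n => continuous_apply (n + 1)

theorem fst_iterate_biShift (n : ℕ) (p : BSpace d × BSpace d) :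
    (biShift^[n] p).1 = shift^[n] p.1 := by
  induction n with
  | zero => rfl
  | succ n ih => rw [Function.iterate_succ_apply', Function.iterate_succ_apply', ← ih]; rfl

theorem snd_iterate_biShift (n : ℕ) (p : BSpace d × BSpace d) (j : ℕ) (hj : j < n) :
    (biShift^[n] p).2 j = p.1 (n - 1 - j) := by
  have hs : ∀ (n : ℕ) (x : BSpace d) (i : ℕ), (shift^[n] x) i = x (n + i) := by
    intro n
    induction n with
    | zero => intro x i; simp
    | succ n ih =>
      intro x i
      rw [Function.iterate_succ_apply, ih]
      exact congrArg x (by omega)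
  induction n generalizing j with
  | zero => omega
  | succ n ih =>
    rw [Function.iterate_succ_apply']
    cases j with
    | zero =>
      change (biShift^[n] p).1 0 = _
      rw [fst_iterate_biShift, hs]
      simp
    | succ j =>
      change (biShift^[n] p).2 j = _
      rw [ih j (by omega)]
      exact congrArg p.1 (by omega)

/-- Points with the same future and a common period coincide. -/
theorem eq_of_fst_eq_of_isPeriodicPt {P : ℕ} (hP : 0 < P) {p q : BSpace d × BSpace d}
    (hp : biShift^[P] p = p) (hq : biShift^[P] q = q) (h : p.1 = q.1) : p = q := by
  refine Prod.ext h (funext fun j => ?_)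
  -- After `n` shifts the first `n` past symbols are the first `n` future symbols reversed; a
  -- multiple of the period exceeding `j` thus fixes the past at `j`.
  have hlt : j < P * (j + 1) := by nlinarith
  have hp' : biShift^[P * (j + 1)] p = p := Function.IsPeriodicPt.mul_const hp (j + 1)
  have hq' : biShift^[P * (j + 1)] q = q := Function.IsPeriodicPt.mul_const hq (j + 1)
  rw [← hp', ← hq', snd_iterate_biShift _ _ _ hlt, snd_iterate_biShift _ _ _ hlt, h]

/-! ### Lexicographic order, and points of `D` on both sides. -/

theorem lexLT_prepend {a : Fin d} {x z : BSpace d} (h : LexLT x z) :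
    LexLT (prepend a x) (prepend a z) := by
  obtain ⟨i, hi, hlt⟩ := h
  refine ⟨i + 1, fun j hj => ?_, hlt⟩
  cases j with
  | zero => rfl
  | succ j => exact hi j (by simpa using hj)

theorem lexLE_of_prepend {a : Fin d} {x z : BSpace d} (h : LexLE (prepend a x) (prepend a z)) :
    LexLE x z := by
  by_contra hlt
  exact (lexLT_prepend (lexLT_of_not_le hlt)).not_le h

/-- A set invariant under the shift and under all its inverse branches contains points on the left
of each of its points which is not fixed by the shift. -/
theorem exists_lexLT_of_shift_ne {D : Set (BSpace d)} (h₁ : ∀ x ∈ D, shift x ∈ D)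
    (h₂ : ∀ x ∈ D, ∀ a, prepend a x ∈ D) {x : BSpace d} (hx : x ∈ D) (hne : shift x ≠ x) :
    (∃ z ∈ D, LexLT z x) ∧ ∃ z ∈ D, LexLT x z := by
  constructor
  · by_contra! hmin
    have hmin' : ∀ z ∈ D, LexLE x z := fun z hz => not_lt.1 (hmin z hz)
    -- A least point `x` satisfies `x ≤ σ x`; also `x` is at most its preimage `(x₀, x)`, and
    -- cancelling the symbol `x₀` gives `σ x ≤ x`.
    refine hne (LexLE.antisymm ?_ (hmin' _ (h₁ x hx)))
    apply lexLE_of_prepend (a := x 0)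
    rw [prepend_shift]
    exact hmin' _ (h₂ x hx _)
  · by_contra! hmax
    have hmax' : ∀ z ∈ D, LexLE z x := fun z hz => not_lt.1 (hmax z hz)
    refine hne (LexLE.antisymm (hmax' _ (h₁ x hx)) ?_)
    apply lexLE_of_prepend (a := x 0)
    rw [prepend_shift]
    exact hmax' _ (h₂ x hx _)

/-! ### The subaction defect and its vanishing on the support. -/

theorem IsHolder.continuous {A : BSpace d → ℝ} (hA : IsHolder A) : Continuous A := by
  obtain ⟨C, θ, h0, h1, h⟩ := hA
  rw [continuous_iff_continuousAt]
  intro x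
  rw [ContinuousAt, Metric.tendsto_nhds]
  intro ε hε
  have ht : Filter.Tendsto (fun n : ℕ => C * θ ^ n) Filter.atTop (nhds 0) := by
    simpa using (tendsto_pow_atTop_nhds_zero_of_lt_one h0.le h1).const_mul C
  obtain ⟨n, hn⟩ := (ht.eventually (gt_mem_nhds hε)).exists
  have hU : ∀ᶠ z in nhds x, ∀ i ∈ Finset.range n, z i = x i := by
    rw [Filter.eventually_all_finset]
    intro i _
    exact ((continuous_apply i).tendsto x).eventually
      (IsOpen.mem_nhds (isOpen_discrete {x i}) rfl)
  filter_upwards [hU] with z hz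
  rw [Real.dist_eq]
  exact (h n z x fun i hi => hz i (Finset.mem_range.2 hi)).trans_lt hn

/-- The defect `V ∘ σ - V - A + m(A)` of the subaction `V`. -/
noncomputable def defect (A V : BSpace d → ℝ) (x : BSpace d) : ℝ :=
  V (shift x) - V x - A x + maxValue A

section Subaction

variable {A V : BSpace d → ℝ}

theorem defect_nonneg (hV : IsCalibratedSubaction A V) (x : BSpace d) : 0 ≤ defect A V x := by
  have := (hV.2 (shift x)).2 (Set.mem_image_of_mem _ (show x ∈ {z | shift z = shift x} from rfl))
  simp only [defect] at *
  linarith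

theorem continuous_defect (hA : Continuous A) (hV : Continuous V) : Continuous (defect A V) :=
  (((hV.comp continuous_shift).sub hV).sub hA).add continuous_const

theorem deviation_eq_add (x : BSpace d) :
    deviation A V x = ENNReal.ofReal (defect A V x) + deviation A V (shift x) := by
  unfold deviation
  rw [tsum_eq_zero_add' ENNReal.summable]
  rfl

theorem integral_defect_eq_zero (hA : Continuous A) (hV : Continuous V) {μ : Measure (BSpace d)}
    (hμ : IsMaximizing A μ) : ∫ x, defect A V x ∂μ = 0 := by
  have := hμ.1.1
  have hi : ∀ {f : BSpace d → ℝ}, Continuous f → Integrable f μ := fun hf =>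
    hf.integrable_of_hasCompactSupport (HasCompactSupport.of_compactSpace _)
  have hmax : maxValue A = ∫ x, A x ∂μ := by
    refine IsGreatest.csSup_eq ⟨⟨μ, hμ.1, rfl⟩, ?_⟩
    rintro _ ⟨ν, hν, rfl⟩
    exact hμ.2 ν hν
  have hVs : ∫ x, V (shift x) ∂μ = ∫ x, V x ∂μ := by
    have := integral_map (μ := μ) hμ.1.2.measurable.aemeasurable (f := V)
      hV.aestronglyMeasurable
    rw [hμ.1.2.map_eq] at this
    exact this.symm
  have hs := hi (hV.comp continuous_shift)
  simp only [Function.comp_def] at hs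
  have h1 : Integrable (fun x => V (shift x) - V x) μ := hs.sub (hi hV)
  have h2 : Integrable (fun x => V (shift x) - V x - A x) μ := h1.sub (hi hA)
  unfold defect
  rw [integral_add h2 (integrable_const _), integral_sub h1 (hi hA), integral_sub hs (hi hV), hVs,
    integral_const, hmax]
  simp

/-- The defect vanishes on the futures of the support of the natural extension. -/
theorem defect_eq_zero_of_mem_support (hA : Continuous A) (hV : IsCalibratedSubaction A V)
    {μ : Measure (BSpace d)} (hμ : IsMaximizing A μ) {μhat : Measure (BSpace d × BSpace d)}
    (hμhat : IsNaturalExtension μ μhat) {p : BSpace d × BSpace d} (hp : p ∈ μhat.support) :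
    defect A V p.1 = 0 := by
  have := hμhat.1
  have hc : Continuous fun q : BSpace d × BSpace d => defect A V q.1 :=
    (continuous_defect hA hV.1).comp continuous_fst
  have h0 : ∫ q, defect A V q.1 ∂μhat = 0 := by
    rw [← integral_defect_eq_zero hA hV.1 hμ, ← hμhat.2.2, integral_map measurable_fst.aemeasurable
      (continuous_defect hA hV.1).aestronglyMeasurable]
  rw [integral_eq_zero_iff_of_nonneg
    (f := fun q : BSpace d × BSpace d => defect A V q.1) (fun q => defect_nonneg hV q.1)
    (hc.integrable_of_hasCompactSupport (HasCompactSupport.of_compactSpace _))] at h0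
  by_contra hne
  have hU : IsOpen {q : BSpace d × BSpace d | defect A V q.1 ≠ 0} := isOpen_ne_fun hc continuous_const
  have h1 : μhat {q : BSpace d × BSpace d | defect A V q.1 ≠ 0} = 0 := ae_iff.1 h0
  exact ((Filter.basis_sets _).mem_measureSupport.1 hp _ (hU.mem_nhds hne)).ne' h1

end Subaction

/-! ### The involution kernel against the subaction. -/

section Kernel

variable {A V : BSpace d → ℝ} {W : BSpace d × BSpace d → ℝ}

theorem snd_iterate_biShiftInv_eq (n : ℕ) (x z y : BSpace d) :
    (biShiftInv^[n] (x, y)).2 = (biShiftInv^[n] (z, y)).2 := by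
  induction n with
  | zero => rfl
  | succ n ih =>
    rw [Function.iterate_succ_apply', Function.iterate_succ_apply']
    exact congrArg shift ih

theorem fst_iterate_biShiftInv_eq (n : ℕ) (x z y : BSpace d) (i : ℕ) (hi : i < n) :
    (biShiftInv^[n] (x, y)).1 i = (biShiftInv^[n] (z, y)).1 i := by
  induction n generalizing i with
  | zero => omega
  | succ n ih =>
    rw [Function.iterate_succ_apply', Function.iterate_succ_apply']
    cases i with
    | zero => exact congrFun (snd_iterate_biShiftInv_eq n x z y) 0
    | succ i => exact ih i (by omega)

/-- On an invariant set where the defect of the subaction vanishes, the differences of the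
involution kernel dominate those of the subaction. -/
theorem sub_le_sub_of_defect_eq_zero (hW : IsInvolutionKernel A W)
    (hV : IsCalibratedSubaction A V) {S : Set (BSpace d × BSpace d)}
    (hS : ∀ p ∈ S, biShiftInv p ∈ S) (hS0 : ∀ p ∈ S, defect A V p.1 = 0)
    {P : ℕ} (hP : 0 < P) {a b : BSpace d} (hab : (a, b) ∈ S)
    (hper : biShiftInv^[P] (a, b) = (a, b)) (z : BSpace d) :
    V a - V z ≤ W (a, b) - W (z, b) := by
  obtain ⟨Adual, hAd⟩ := hW.2
  -- Subtracting the kernel identity at `a` and `z` removes `Adual`; the defect is zero on the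
  -- branch of `a` and nonnegative on that of `z`.
  have step : ∀ a z b, (a, b) ∈ S →
      W ((biShiftInv (a, b)).1, (biShiftInv (a, b)).2) - V (biShiftInv (a, b)).1
        - (W ((biShiftInv (z, b)).1, (biShiftInv (z, b)).2) - V (biShiftInv (z, b)).1)
        ≤ W (a, b) - V a - (W (z, b) - V z) := by
    intro a z b h
    have h1 := hS0 _ (hS _ h)
    have h2 := defect_nonneg hV (prepend (b 0) z)
    have h3 := hAd a b
    have h4 := hAd z b
    simp only [defect, biShiftInv, shift_prepend] at *
    linarith
  have iter : ∀ n, biShiftInv^[n] (a, b) ∈ S ∧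
      W (biShiftInv^[n] (a, b)) - V (biShiftInv^[n] (a, b)).1
        - (W (biShiftInv^[n] (z, b)) - V (biShiftInv^[n] (z, b)).1)
        ≤ W (a, b) - V a - (W (z, b) - V z) := by
    intro n
    induction n with
    | zero => exact ⟨hab, le_rfl⟩
    | succ n ih =>
      rw [Function.iterate_succ_apply', Function.iterate_succ_apply']
      refine ⟨hS _ ih.1, le_trans ?_ ih.2⟩
      have h := snd_iterate_biShiftInv_eq n z a b
      have := step (biShiftInv^[n] (a, b)).1 (biShiftInv^[n] (z, b)).1 (biShiftInv^[n] (a, b)).2 ih.1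
      rwa [show ((biShiftInv^[n] (z, b)).1, (biShiftInv^[n] (a, b)).2) = biShiftInv^[n] (z, b) from
        Prod.ext rfl h.symm] at this
  have hfix : ∀ n, biShiftInv^[P * n] (a, b) = (a, b) := fun n =>
    Function.IsPeriodicPt.mul_const hper n
  -- Backward iteration puts the same symbols in front of both futures, so along multiples of the
  -- period `(z, b)` tends to the fixed point `(a, b)`, where the difference is zero.
  have hlim : Filter.Tendsto (fun n => biShiftInv^[P * n] (z, b)) Filter.atTop (nhds (a, b)) := by
    rw [nhds_prod_eq]
    refine Filter.Tendsto.prodMk (m₁ := fun n => (biShiftInv^[P * n] (z, b)).1)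
      (m₂ := fun n => (biShiftInv^[P * n] (z, b)).2) ?_ ?_
    · rw [tendsto_pi_nhds]
      intro i
      apply tendsto_const_nhds.congr'
      filter_upwards [Filter.eventually_gt_atTop i] with n hn
      rw [fst_iterate_biShiftInv_eq _ z a b i (by nlinarith), hfix]
    · apply tendsto_const_nhds.congr
      intro n
      rw [snd_iterate_biShiftInv_eq _ z a b, hfix]
  have hcont : Continuous fun q : BSpace d × BSpace d => W (a, b) - V a - (W q - V q.1) :=
    continuous_const.sub (hW.1.sub (hV.1.comp continuous_fst))
  have := le_of_tendsto ((hcont.tendsto _).comp hlim) (Filter.Eventually.of_forall fun n => by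
    have := (iter (P * n)).2
    rwa [hfix] at this)
  simp only [sub_self] at this
  linarith

end Kernel

/-! ### Reduction of the extended cost to real values. -/

section Cost

variable {A V : BSpace d → ℝ} {W : BSpace d × BSpace d → ℝ} {γ : ℝ}

/-- The values of the cost where it is finite. -/
noncomputable def realCost (A V : BSpace d → ℝ) (W : BSpace d × BSpace d → ℝ) (γ : ℝ)
    (x y : BSpace d) : ℝ :=
  (deviation A V x).toReal - W (x, y) + γ

theorem cost_eq_realCost {x : BSpace d} (hx : deviation A V x ≠ ⊤) (y : BSpace d) :
    cost A V W γ x y = realCost A V W γ x y := by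
  rw [cost, realCost, ← EReal.coe_ennreal_toReal hx]
  push_cast
  rfl

theorem cost_eq_top {x : BSpace d} (hx : deviation A V x = ⊤) (y : BSpace d) :
    cost A V W γ x y = ⊤ := by
  rw [cost, hx, EReal.coe_ennreal_top, EReal.top_sub_coe, EReal.top_add_coe]

/-- Finiteness of the cost depends on the future alone, so only futures need restricting. -/
theorem realTwist_realCost (h : IsTwist (cost A V W γ)) :
    RealTwist {x | deviation A V x ≠ ⊤} (realCost A V W γ) := by
  intro a ha a' ha' b b' hlt hlt'
  have := h a a' b b' hlt hlt'
  simp only [cost_eq_realCost ha, cost_eq_realCost ha'] at this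
  simpa only [← EReal.coe_add, EReal.coe_lt_coe_iff, ne_eq, EReal.coe_ne_top, not_false_eq_true,
    forall_const] using this

end Cost

end BernoulliTransport

/-! ### The periodic support as a monotone chain. -/

open BernoulliTransport in
theorem theorem6 (d : ℕ) (A : BSpace d → ℝ) (hA : IsHolder A)
    (μ : Measure (BSpace d)) (hμ : IsMaximizing A μ)
    (hμ_unique : ∀ ν : Measure (BSpace d), IsMaximizing A ν → ν = μ)
    (μhat : Measure (BSpace d × BSpace d)) (hμhat : IsNaturalExtension μ μhat)
    (W : BSpace d × BSpace d → ℝ) (hW : IsInvolutionKernel A W)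
    (V : BSpace d → ℝ) (hV : IsCalibratedSubaction A V) (γ : ℝ)
    (htwist : IsTwist (cost A V W γ))
    (hper : ∃ q ∈ Function.periodicPts (biShift (d := d)),
      μhat.support = Set.range (fun n : ℕ => biShift^[n] q))
    (x₀ y₀ : BSpace d) (h₀ : (x₀, y₀) ∈ μhat.support)
    (hx₀ : ∀ p ∈ μhat.support, LexLE x₀ p.1)
    (hy₀ : ∀ y, (x₀, y) ∈ μhat.support → LexLE y₀ y) :
    ∃ (N : ℕ) (p : ℕ → BSpace d × BSpace d),
      p 0 = (x₀, y₀) ∧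
      -- `p 0, …, p N` lists the support, in strictly increasing order of first coordinates
      p '' Set.Iic N = μhat.support ∧
      (∀ i j, i < j → j ≤ N → LexLT (p i).1 (p j).1) ∧
      -- the potential at `z` is the chain sum over the support points to the left of `z`
      -- (over the base point alone if there are none)
      (∀ (z : BSpace d) (n : ℕ), n ≤ N → (n = 0 ∨ LexLT (p n).1 z) →
        (∀ j, n < j → j ≤ N → LexLE z (p j).1) →
        potential (cost A V W γ) μhat.support (x₀, y₀) z = chainSum (cost A V W γ) p n z) ∧
      -- the `c`-subderivatives of the potential at the points of the projected support
      (∀ k, k ≤ N → (p k).2 ∈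
        cSubdiff (cost A V W γ) (potential (cost A V W γ) μhat.support (x₀, y₀)) (p k).1) ∧
      (1 ≤ N →
        cSubdiff (cost A V W γ) (potential (cost A V W γ) μhat.support (x₀, y₀)) x₀ = {y₀}) ∧
      (∀ k, k < N →
        cSubdiff (cost A V W γ) (potential (cost A V W γ) μhat.support (x₀, y₀)) (p (k + 1)).1
          = {y | LexLE (p (k + 1)).2 y ∧ LexLE y (p k).2}) := by
  obtain ⟨q, hq, hSq⟩ := hper
  obtain ⟨P, hP, hqP⟩ := hq
  set S := μhat.support with hSdef
  have hSP : ∀ p ∈ S, biShift^[P] p = p := by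
    intro p hp
    rw [hSq] at hp
    obtain ⟨n, rfl⟩ := hp
    exact Function.IsPeriodicPt.apply_iterate hqP n
  have horbit : ∀ p ∈ S, ∀ r ∈ S, ∃ n, biShift^[n] p = r := by
    intro p hp r hr
    rw [hSq] at hp hr
    obtain ⟨n, rfl⟩ := hp
    obtain ⟨m, rfl⟩ := hr
    refine ⟨m + (P * n - n), ?_⟩
    have hle : n ≤ P * n := Nat.le_mul_of_pos_left n hP
    simp only
    rw [← Function.iterate_add_apply, show m + (P * n - n) + n = m + P * n by omega,
      Function.iterate_add_apply]
    exact congrArg _ (Function.IsPeriodicPt.mul_const hqP n)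
  have hSshift : ∀ p ∈ S, ∀ n, biShift^[n] p ∈ S := by
    intro p hp n
    rw [hSq] at hp ⊢
    obtain ⟨m, rfl⟩ := hp
    exact ⟨n + m, Function.iterate_add_apply _ _ _ _⟩
  have hSinv : ∀ p ∈ S, biShiftInv p ∈ S := by
    intro p hp
    have h : biShift (biShift^[P - 1] p) = p := by
      rw [← Function.iterate_succ_apply' biShift, Nat.succ_eq_add_one, Nat.sub_add_cancel hP, hSP p hp]
    rw [← h, biShiftInv_biShift]
    exact hSshift p hp _
  have hSinvP : ∀ p ∈ S, biShiftInv^[P] p = p := by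
    intro p hp
    conv_lhs => rw [← hSP p hp]
    exact biShiftInv_biShift.iterate P p
  have hSfin : S.Finite := by
    rw [hSq]
    refine (Set.finite_range fun i : Fin P => biShift^[(i : ℕ)] q).subset ?_
    rintro _ ⟨n, rfl⟩
    refine ⟨⟨n % P, Nat.mod_lt _ hP⟩, ?_⟩
    exact Function.IsPeriodicPt.iterate_mod_apply hqP n
  have hdef : ∀ p ∈ S, defect A V p.1 = 0 := fun p hp =>
    defect_eq_zero_of_mem_support hA.continuous hV hμ hμhat hp
  have hdev : ∀ p ∈ S, deviation A V p.1 = 0 := by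
    intro p hp
    refine ENNReal.tsum_eq_zero.2 fun n => ?_
    have := hdef _ (hSshift p hp n)
    rw [fst_iterate_biShift, defect] at this
    rw [this, ENNReal.ofReal_zero]
  have hinj : S.InjOn fun p => toLex p.1 := fun p hp r hr h =>
    eq_of_fst_eq_of_isPeriodicPt hP (hSP p hp) (hSP r hr) (toLex.injective h)
  set D : Set (BSpace d) := {x | deviation A V x ≠ ⊤} with hD
  have hSD : ∀ p ∈ S, p.1 ∈ D := fun p hp => by
    rw [hD, Set.mem_ofPred_eq, hdev p hp]
    exact ENNReal.zero_ne_top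
  have htw : RealTwist D (realCost A V W γ) := realTwist_realCost htwist
  have hanti : ∀ p ∈ S, ∀ r ∈ S, LexLT p.1 r.1 → LexLE r.2 p.2 := by
    rintro ⟨a, b⟩ hp ⟨a', b'⟩ hr hlt
    by_contra hlt'
    -- The deviations cancel in `h1`, and the values of `V` cancel in `h2 + h3`, leaving opposite
    -- inequalities for `W`.
    have h1 := htw a (hSD _ hp) a' (hSD _ hr) b b' hlt (lexLT_of_not_le hlt')
    have h2 := sub_le_sub_of_defect_eq_zero hW hV hSinv hdef hP hp (hSinvP _ hp) a'
    have h3 := sub_le_sub_of_defect_eq_zero hW hV hSinv hdef hP hr (hSinvP _ hr) a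
    simp only [realCost] at h1
    linarith
  obtain ⟨N, p, hpS, hplt⟩ := exists_strictMono_enumeration hSfin ⟨_, h₀⟩ _ hinj
  have hpm : ∀ j ≤ N, p j ∈ S := fun j hj => hpS ▸ Set.mem_image_of_mem p hj
  have hp0 : p 0 = (x₀, y₀) := by
    obtain ⟨i, hi, hpi⟩ : (x₀, y₀) ∈ p '' Set.Iic N := hpS.symm ▸ h₀
    rcases Nat.eq_zero_or_pos i with rfl | h
    · exact hpi
    · have := hplt 0 i h hi
      rw [hpi] at this
      exact absurd (hx₀ _ (hpm 0 (Nat.zero_le _))) (not_le_of_gt this)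
  have H : MonotoneChain D (realCost A V W γ) (cost A V W γ) p N :=
    { twist := htw
      finite := fun z hz y => cost_eq_realCost hz y
      infinite := fun z hz y => cost_eq_top (not_not.1 hz) y
      mem := fun j hj => hSD _ (hpm j hj)
      lt := hplt
      ge := fun i j hij hj => by
        rcases hij.eq_or_lt with rfl | h
        · exact LexLE.refl _
        · exact hanti _ (hpm i (hij.trans hj)) _ (hpm j hj) (hplt i j h hj) }
  have hDshift : ∀ x ∈ D, shift x ∈ D := fun x hx h => hx <| by
    rw [deviation_eq_add, h, add_top]
  have hDpre : ∀ x ∈ D, ∀ a, prepend a x ∈ D := fun x hx a => by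
    rw [hD, Set.mem_ofPred_eq, deviation_eq_add, shift_prepend]
    exact ENNReal.add_ne_top.2 ⟨ENNReal.ofReal_ne_top, hx⟩
  have hext : 1 ≤ N → ∀ j ≤ N, (∃ z ∈ D, LexLT z (p j).1) ∧ ∃ z ∈ D, LexLT (p j).1 z := by
    intro hN j hj
    -- A shift-fixed future would be the only future on the orbit, whereas `N ≥ 1` gives two.
    refine exists_lexLT_of_shift_ne hDshift hDpre (H.mem j hj) fun hfix => ?_
    have hconst : ∀ r ∈ S, r.1 = (p j).1 := by
      intro r hr
      obtain ⟨n, rfl⟩ := horbit _ (hpm j hj) r hr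
      rw [fst_iterate_biShift]
      exact Function.iterate_fixed hfix n
    have := hplt 0 1 Nat.one_pos hN
    rw [hconst _ (hpm 0 (Nat.zero_le _)), hconst _ (hpm 1 hN)] at this
    exact lt_irrefl _ this
  have hmem : ∀ k ≤ N, (p k).2 ∈
      cSubdiff (cost A V W γ) (potential (cost A V W γ) (p '' Set.Iic N) (p 0)) (p k).1 :=
    fun k hk => H.mem_cSubdiff hk (LexLE.refl _) (fun j hj => H.ge j k hj.le hk)
      (H.ge 0 k (Nat.zero_le _) hk)
  refine ⟨N, p, hp0, hpS, hplt, ?_⟩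
  rw [← hpS, ← hp0]
  refine ⟨fun z n hn hnz hzn => H.potential_eq hn (hnz.imp_right LexLT.le) hzn, hmem, ?_, ?_⟩
  · intro hN
    obtain rfl : x₀ = (p 0).1 := by rw [hp0]
    obtain rfl : y₀ = (p 0).2 := by rw [hp0]
    refine Set.Subset.antisymm (fun y hy => ?_)
      (Set.singleton_subset_iff.2 (hmem 0 (Nat.zero_le _)))
    exact (H.le_of_mem_cSubdiff_zero (hext hN 0 (Nat.zero_le _)).1 hy).antisymm
      (H.ge_of_mem_cSubdiff (hext hN N le_rfl).2 (Nat.zero_le _) hy)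
  · intro k hk
    refine Set.Subset.antisymm (fun y hy => ?_) (fun y hy => ?_)
    · exact ⟨H.ge_of_mem_cSubdiff (hext (by omega) N le_rfl).2 hk hy, H.le_of_mem_cSubdiff hk hy⟩
    · exact H.mem_cSubdiff hk hy.1
        (fun j hj => hy.2.trans (H.ge j k (Nat.lt_succ_iff.1 hj) hk.le))
        (hy.2.trans (H.ge 0 k (Nat.zero_le _) hk.le))
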